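/- Let $\mathcal O_2$ be the Cuntz algebra, i.e. the universal unital $C^*$-algebra generated by two isometries $X_1,X_2$ with $X_1X_1^*+X_2X_2^*=1$, and let $\mathcal Q_2$ be the $2$-adic ring $C^*$-algebra, i.e. the universal unital $C^*$-algebra generated by a unitary $U$ and an isometry $S_2$ with $S_2U=U^2S_2$ and $S_2S_2^*+US_2S_2^*U^*=1$. View $\mathcal O_2$ inside $\mathcal Q_2$ through the $*$-homomorphism $\iota$ with $\iota(X_1)=US_2$ and $\iota(X_2)=S_2$. All representations are unital $*$-representations on a complex Hilbert space $H$, and a representation $\rho:\mathcal Q_2\to B(H)$ extends $\pi:\mathcal O_2\to B(H)$ if $\rho\circ\iota=\pi$. A representation $\pi:\mathcal O_2\to B(H)$ is called permutative if there are an orthonormal basis $\{e_n:n\in\mathbb N\}$ of $H$ and injections $\sigma_1,\sigma_2:\mathbb N\to\mathbb N$ with $\sigma_1(\mathbb N)\cap\sigma_2(\mathbb N)=\emptyset$ and $\sigma_1(\mathbb N)\cup\sigma_2(\mathbb N)=\mathbb N$ such that $\pi(X_i)e_n=e_{\sigma_i(n)}$ for all $n\in\mathbb N$ and $i=1,2$.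 A representation $\rho:\mathcal Q_2\to B(H)$ is called permutative if there are an orthonormal basis $\{f_n:n\in\mathbb N\}$ of $H$, an injection $\sigma$ of $\mathbb N$ into itself and a bijection $\tau$ of $\mathbb N$ such that $\rho(S_2)f_n=f_{\sigma(n)}$ and $\rho(U)f_n=f_{\tau(n)}$ for all $n\in\mathbb N$. Theorem. If a permutative representation $\pi:\mathcal O_2\to B(H)$ extends to some (not necessarily permutative) representation of $\mathcal Q_2$ on $H$, then $\pi$ also has an extension to $\mathcal Q_2$ on $H$ that is permutative (with respect to some orthonormal basis of $H$, which need not be the basis that makes $\pi$ permutative). -/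

import Mathlib

open scoped ENNReal

noncomputable section

namespace TwoAdic

/-! ### Universal unital C*-algebras on two contractive generators -/

/-- A property of pairs of elements of (small) unital C*-algebras. -/
abbrev PairRelation : Type 1 := ∀ (A : Type) [CStarAlgebra A], A → A → Prop

/-- The relation forces both elements to be contractions. -/
def PairRelation.Contractive (R : PairRelation) : Prop :=
  ∀ (A : Type) [CStarAlgebra A] (a b : A), R A a b → ‖a‖ ≤ 1 ∧ ‖b‖ ≤ 1

/-- A nonzero unital C*-algebra together with a pair of elements satisfying the relation. -/
structure Realization (R : PairRelation) : Type 1 where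
  carrier : Type
  cstar : CStarAlgebra carrier
  nontrivial : Nontrivial carrier
  fst : carrier
  snd : carrier
  rel : R carrier fst snd

namespace Realization

variable {R : PairRelation}

instance (x : Realization R) : CStarAlgebra x.carrier := x.cstar

instance (x : Realization R) : Nontrivial x.carrier := x.nontrivial

end Realization

/-- The `ℓ^∞`-product of all realizations of the relation: bounded families, one element for
each realization, with the pointwise operations and the supremum norm. -/
abbrev BigProduct (R : PairRelation) : Type 1 :=
  lp (fun x : Realization R => x.carrier) ∞

/-- The family formed by the first elements of all realizations. -/
def bigFst (R : PairRelation) (hR : R.Contractive) : BigProduct R :=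
  ⟨fun x => x.fst, memℓp_infty ⟨1, by
    rintro _ ⟨x, rfl⟩
    exact (hR _ _ _ x.rel).1⟩⟩

/-- The family formed by the second elements of all realizations. -/
def bigSnd (R : PairRelation) (hR : R.Contractive) : BigProduct R :=
  ⟨fun x => x.snd, memℓp_infty ⟨1, by
    rintro _ ⟨x, rfl⟩
    exact (hR _ _ _ x.rel).2⟩⟩

instance (R : PairRelation) : CStarAlgebra (BigProduct R) where

/-- The universal unital C*-algebra generated by a pair of elements subject to the relation: the
closed unital *-subalgebra generated by the two universal families in the product of all
realizations. Its universal property is `universal_property` below. -/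
def universalSubalgebra (R : PairRelation) (hR : R.Contractive) :
    StarSubalgebra ℂ (BigProduct R) :=
  (StarAlgebra.adjoin ℂ {bigFst R hR, bigSnd R hR}).topologicalClosure

/-- The universal C*-algebra as a type. -/
abbrev Universal (R : PairRelation) (hR : R.Contractive) : Type 1 :=
  universalSubalgebra R hR

theorem isClosed_universalSubalgebra (R : PairRelation) (hR : R.Contractive) :
    IsClosed (universalSubalgebra R hR : Set (BigProduct R)) :=
  StarSubalgebra.isClosed_topologicalClosure _

instance (R : PairRelation) (hR : R.Contractive) : CStarAlgebra (Universal R hR) :=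
  haveI := isClosed_universalSubalgebra R hR
  StarSubalgebra.cstarAlgebra (universalSubalgebra R hR)

/-- The first universal generator. -/
def gen₁ (R : PairRelation) (hR : R.Contractive) : Universal R hR :=
  ⟨bigFst R hR, StarSubalgebra.le_topologicalClosure _
    (StarAlgebra.subset_adjoin ℂ _ (Set.mem_insert _ _))⟩

/-- The second universal generator. -/
def gen₂ (R : PairRelation) (hR : R.Contractive) : Universal R hR :=
  ⟨bigSnd R hR, StarSubalgebra.le_topologicalClosure _
    (StarAlgebra.subset_adjoin ℂ _ (Set.mem_insert_of_mem _ rfl))⟩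

/-- Evaluation of a bounded family at a realization. -/
def evalAt {R : PairRelation} (x : Realization R) : BigProduct R →⋆ₐ[ℂ] x.carrier where
  toFun f := f x
  map_one' := rfl
  map_mul' _ _ := rfl
  map_zero' := rfl
  map_add' _ _ := rfl
  commutes' _ := rfl
  map_star' _ := rfl

/-- *-homomorphisms between C*-algebras are continuous. -/
theorem continuous_starAlgHom {A B : Type*} [CStarAlgebra A] [CStarAlgebra B] (φ : A →⋆ₐ[ℂ] B) :
    Continuous φ :=
  AddMonoidHomClass.continuous_of_bound φ 1 fun x => by
    rw [one_mul]
    exact NonUnitalStarAlgHom.norm_apply_le φ x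

/-- Two *-homomorphisms out of the universal C*-algebra that agree on the generators are equal. -/
theorem universal_hom_ext {R : PairRelation} {hR : R.Contractive} {B : Type*} [CStarAlgebra B]
    {φ ψ : Universal R hR →⋆ₐ[ℂ] B} (h₁ : φ (gen₁ R hR) = ψ (gen₁ R hR))
    (h₂ : φ (gen₂ R hR) = ψ (gen₂ R hR)) : φ = ψ := by
  refine StarAlgHom.ext_topologicalClosure (continuous_starAlgHom φ) (continuous_starAlgHom ψ) ?_
  refine StarAlgHom.ext_adjoin ?_
  rintro ⟨x, hx⟩ h
  rcases h with rfl | rfl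
  · exact h₁
  · exact h₂

/-- The universal property: every pair satisfying the relation in a unital C*-algebra is the image
of the pair of generators under exactly one unital *-homomorphism. -/
theorem universal_property (R : PairRelation) (hR : R.Contractive) (A : Type) [CStarAlgebra A]
    (a b : A) (hab : R A a b) :
    ∃! φ : Universal R hR →⋆ₐ[ℂ] A, φ (gen₁ R hR) = a ∧ φ (gen₂ R hR) = b := by
  refine existsUnique_of_exists_of_unique ?_ fun φ ψ hφ hψ =>
    universal_hom_ext (hφ.1.trans hψ.1.symm) (hφ.2.trans hψ.2.symm)
  rcases subsingleton_or_nontrivial A with hA | hA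
  · exact ⟨{ toFun := fun _ => 0
             map_one' := Subsingleton.elim _ _
             map_mul' := fun _ _ => Subsingleton.elim _ _
             map_zero' := Subsingleton.elim _ _
             map_add' := fun _ _ => Subsingleton.elim _ _
             commutes' := fun _ => Subsingleton.elim _ _
             map_star' := fun _ => Subsingleton.elim _ _ },
      Subsingleton.elim _ _, Subsingleton.elim _ _⟩
  · exact ⟨(evalAt (R := R) ⟨A, inferInstance, hA, a, b, hab⟩).comp
      (universalSubalgebra R hR).subtype, rfl, rfl⟩

/-! ### The Cuntz algebra and the 2-adic ring C*-algebra -/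

/-- Two isometries `x₁`, `x₂` with `x₁ x₁* + x₂ x₂* = 1`. -/
structure IsCuntzPair {A : Type*} [Ring A] [StarRing A] (x₁ x₂ : A) : Prop where
  isometry₁ : star x₁ * x₁ = 1
  isometry₂ : star x₂ * x₂ = 1
  sum_range : x₁ * star x₁ + x₂ * star x₂ = 1

/-- A unitary `u` and an isometry `s` with `s u = u² s` and `s s* + u s s* u* = 1`. In a nonzero
algebra the last relation forces `s` to be a proper isometry. -/
structure IsTwoAdicPair {A : Type*} [Ring A] [StarRing A] (u s : A) : Prop where
  unitary : u ∈ unitary A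
  isometry : star s * s = 1
  comm : s * u = u ^ 2 * s
  sum_range : s * star s + u * s * star s * star u = 1

theorem norm_le_one_of_isometry {A : Type*} [CStarAlgebra A] {a : A} (h : star a * a = 1) :
    ‖a‖ ≤ 1 := by
  rcases subsingleton_or_nontrivial A with hA | hA
  · rw [Subsingleton.elim a 0, norm_zero]
    exact zero_le_one
  · have h' := CStarRing.norm_star_mul_self (x := a)
    rw [h, norm_one] at h'
    nlinarith [norm_nonneg a]

/-- The relation defining the Cuntz algebra `O₂`. -/
def cuntzRelation : PairRelation := fun _ _ x₁ x₂ => IsCuntzPair x₁ x₂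

/-- The relation defining the 2-adic ring C*-algebra `Q₂`. -/
def twoAdicRelation : PairRelation := fun _ _ u s => IsTwoAdicPair u s

theorem cuntzRelation_contractive : cuntzRelation.Contractive := fun _ _ _ _ h =>
  ⟨norm_le_one_of_isometry h.isometry₁, norm_le_one_of_isometry h.isometry₂⟩

theorem twoAdicRelation_contractive : twoAdicRelation.Contractive := fun _ _ _ _ h =>
  ⟨norm_le_one_of_isometry (Unitary.mem_iff.1 h.unitary).1, norm_le_one_of_isometry h.isometry⟩

/-- The Cuntz algebra `O₂`. -/
abbrev CuntzAlgebra : Type 1 := Universal cuntzRelation cuntzRelation_contractive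

/-- The 2-adic ring C*-algebra `Q₂`. -/
abbrev TwoAdicAlgebra : Type 1 := Universal twoAdicRelation twoAdicRelation_contractive

/-- The generating isometry `X₁` of `O₂`. -/
def cuntzX₁ : CuntzAlgebra := gen₁ cuntzRelation cuntzRelation_contractive

/-- The generating isometry `X₂` of `O₂`. -/
def cuntzX₂ : CuntzAlgebra := gen₂ cuntzRelation cuntzRelation_contractive

/-- The generating unitary `U` of `Q₂`. -/
def twoAdicU : TwoAdicAlgebra := gen₁ twoAdicRelation twoAdicRelation_contractive

/-- The generating isometry `S₂` of `Q₂`. -/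
def twoAdicS : TwoAdicAlgebra := gen₂ twoAdicRelation twoAdicRelation_contractive

theorem isCuntzPair_cuntzX : IsCuntzPair cuntzX₁ cuntzX₂ where
  isometry₁ := Subtype.ext <| Subtype.ext <| funext fun x => x.rel.isometry₁
  isometry₂ := Subtype.ext <| Subtype.ext <| funext fun x => x.rel.isometry₂
  sum_range := Subtype.ext <| Subtype.ext <| funext fun x => x.rel.sum_range

theorem isTwoAdicPair_twoAdic : IsTwoAdicPair twoAdicU twoAdicS where
  unitary := Unitary.mem_iff.2
    ⟨Subtype.ext <| Subtype.ext <| funext fun x => (Unitary.mem_iff.1 x.rel.unitary).1,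
      Subtype.ext <| Subtype.ext <| funext fun x => (Unitary.mem_iff.1 x.rel.unitary).2⟩
  isometry := Subtype.ext <| Subtype.ext <| funext fun x => x.rel.isometry
  comm := Subtype.ext <| Subtype.ext <| funext fun x => x.rel.comm
  sum_range := Subtype.ext <| Subtype.ext <| funext fun x => x.rel.sum_range

/-- If `(u, s)` satisfies the relations of `Q₂`, then `(u s, s)` satisfies those of `O₂`. -/
theorem IsTwoAdicPair.isCuntzPair {A : Type*} [Ring A] [StarRing A] {u s : A}
    (h : IsTwoAdicPair u s) : IsCuntzPair (u * s) s where
  isometry₁ := by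
    rw [star_mul, mul_assoc, ← mul_assoc (star u), (Unitary.mem_iff.1 h.unitary).1, one_mul,
      h.isometry]
  isometry₂ := h.isometry
  sum_range := by
    rw [star_mul, ← mul_assoc, add_comm]
    exact h.sum_range

/-- The realization `(u s, s)` of the Cuntz relations attached to a realization `(u, s)` of the
relations of `Q₂`. -/
def toCuntz (x : Realization twoAdicRelation) : Realization cuntzRelation where
  carrier := x.carrier
  cstar := x.cstar
  nontrivial := x.nontrivial
  fst := x.fst * x.snd
  snd := x.snd
  rel := IsTwoAdicPair.isCuntzPair x.rel

/-- Reindexing of bounded families along `toCuntz`. -/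
def reindex : BigProduct cuntzRelation →⋆ₐ[ℂ] BigProduct twoAdicRelation where
  toFun f := ⟨fun x => f (toCuntz x), memℓp_infty ⟨‖f‖, by
    rintro _ ⟨x, rfl⟩
    exact lp.norm_apply_le_norm ENNReal.top_ne_zero f (toCuntz x)⟩⟩
  map_one' := rfl
  map_mul' _ _ := rfl
  map_zero' := rfl
  map_add' _ _ := rfl
  commutes' _ := rfl
  map_star' _ := rfl

theorem reindex_mem (a : CuntzAlgebra) :
    reindex (a : BigProduct cuntzRelation) ∈
      universalSubalgebra twoAdicRelation twoAdicRelation_contractive := by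
  have hmem : reindex (a : BigProduct cuntzRelation) ∈ StarSubalgebra.map reindex
      (universalSubalgebra cuntzRelation cuntzRelation_contractive) := ⟨a, a.2, rfl⟩
  have h := StarSubalgebra.map_topologicalClosure_le _ reindex (continuous_starAlgHom reindex) hmem
  refine StarSubalgebra.topologicalClosure_minimal ?_
    (isClosed_universalSubalgebra twoAdicRelation twoAdicRelation_contractive) h
  rw [StarAlgHom.map_adjoin]
  refine StarAlgebra.adjoin_le ?_
  rintro _ ⟨y, rfl | rfl, rfl⟩
  · exact (twoAdicU * twoAdicS).2
  · exact twoAdicS.2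

/-- The embedding of `O₂` into `Q₂` that sends `X₁` to `U S₂` and `X₂` to `S₂`. -/
def inclusion : CuntzAlgebra →⋆ₐ[ℂ] TwoAdicAlgebra :=
  StarAlgHom.codRestrict
    (reindex.comp (universalSubalgebra cuntzRelation cuntzRelation_contractive).subtype)
    (universalSubalgebra twoAdicRelation twoAdicRelation_contractive) reindex_mem

theorem inclusion_cuntzX₁ : inclusion cuntzX₁ = twoAdicU * twoAdicS := rfl

theorem inclusion_cuntzX₂ : inclusion cuntzX₂ = twoAdicS := rfl

/-! ### Permutative representations -/

/-- A branching function system of order two on `ℕ`: two injections whose ranges partition `ℕ`. -/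
structure IsBranchingSystem (σ₁ σ₂ : ℕ → ℕ) : Prop where
  injective₁ : Function.Injective σ₁
  injective₂ : Function.Injective σ₂
  disjoint : Disjoint (Set.range σ₁) (Set.range σ₂)
  cover : Set.range σ₁ ∪ Set.range σ₂ = Set.univ

section Representations

variable {H : Type*} [NormedAddCommGroup H] [InnerProductSpace ℂ H] [CompleteSpace H]

/-- A representation of `O₂` is permutative if the generating isometries permute the vectors of
some orthonormal basis indexed by `ℕ` according to a branching function system. -/
def IsPermutativeCuntz (π : CuntzAlgebra →⋆ₐ[ℂ] (H →L[ℂ] H)) : Prop :=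
  ∃ (e : HilbertBasis ℕ ℂ H) (σ₁ σ₂ : ℕ → ℕ), IsBranchingSystem σ₁ σ₂ ∧
    (∀ n, π cuntzX₁ (e n) = e (σ₁ n)) ∧ ∀ n, π cuntzX₂ (e n) = e (σ₂ n)

/-- A representation of `Q₂` is permutative if for some orthonormal basis indexed by `ℕ` the
isometry `S₂` acts through an injection and the unitary `U` through a bijection of the basis. -/
def IsPermutativeTwoAdic (ρ : TwoAdicAlgebra →⋆ₐ[ℂ] (H →L[ℂ] H)) : Prop :=
  ∃ (e : HilbertBasis ℕ ℂ H) (σ₂ τ : ℕ → ℕ), Function.Injective σ₂ ∧ Function.Bijective τ ∧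
    (∀ n, ρ twoAdicS (e n) = e (σ₂ n)) ∧ ∀ n, ρ twoAdicU (e n) = e (τ n)

/-- `ρ` extends `π` on the same Hilbert space, along the embedding of `O₂` into `Q₂`. -/
def Extends (ρ : TwoAdicAlgebra →⋆ₐ[ℂ] (H →L[ℂ] H)) (π : CuntzAlgebra →⋆ₐ[ℂ] (H →L[ℂ] H)) :
    Prop :=
  ρ.comp inclusion = π

end Representations

end TwoAdic

end

namespace TwoAdic

open scoped InnerProductSpace

/-! Every extension turns out to be permutative already; only the basis has to change. Write `S₁ = U
S₂`, so that `U S₁ = S₂ U`. If `n = σ₁^j (σ₂ m)`, then `U (e n) = S₂^j S₁ (e m)` is again a basis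
vector. The remaining indices span `M₁ = ⋂ S₁^k H`, which `U` maps unitarily onto `M₂ = ⋂ S₂^k H`,
in general without respecting `e`.

The remedy is to replace the basis of `M₁` by the vectors `U* (e m)` with `e m ∈ M₂`. Since `S₁ U* =
U* S₂`, these are permuted by `S₁`, and their orbit under `S₁`, `S₂` replaces the part of `e`
indexed by `TailOne`. The vectors of `M₂` lie outside that part, so they are kept and the definition
is not circular. The set obtained is stable under `S₁`, `S₂`, `U` and `U*`; orthogonality and
totality both come from `U` matching `M₁` with `M₂`. -/

/-- The points lying in the range of every iterate of `σ`. -/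
def iteratedRange (σ : ℕ → ℕ) : Set ℕ := {n | ∀ k, n ∈ Set.range σ^[k]}

theorem apply_mem_range_iterate_succ_iff {σ : ℕ → ℕ} (hσ : Function.Injective σ) {n k : ℕ} :
    σ n ∈ Set.range σ^[k + 1] ↔ n ∈ Set.range σ^[k] := by
  simp only [Set.mem_range, Function.iterate_succ_apply', hσ.eq_iff]

theorem apply_mem_iteratedRange_iff {σ : ℕ → ℕ} (hσ : Function.Injective σ) {n : ℕ} :
    σ n ∈ iteratedRange σ ↔ n ∈ iteratedRange σ := by
  refine ⟨fun h k => (apply_mem_range_iterate_succ_iff hσ).1 (h (k + 1)), fun h k => ?_⟩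
  cases k with
  | zero => exact ⟨σ n, rfl⟩
  | succ k => exact (apply_mem_range_iterate_succ_iff hσ).2 (h k)

theorem exists_mem_iteratedRange_apply_eq {σ : ℕ → ℕ} (hσ : Function.Injective σ) {n : ℕ}
    (hn : n ∈ iteratedRange σ) : ∃ m ∈ iteratedRange σ, σ m = n := by
  obtain ⟨m, rfl⟩ := hn 1
  exact ⟨m, (apply_mem_iteratedRange_iff hσ).1 hn, rfl⟩

/-! ### Combinatorics of the branching system. -/

namespace IsBranchingSystem

variable {σ₁ σ₂ : ℕ → ℕ}

theorem apply_ne (h : IsBranchingSystem σ₁ σ₂) (m n : ℕ) : σ₁ m ≠ σ₂ n := fun he =>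
  Set.disjoint_left.1 h.disjoint ⟨m, rfl⟩ ⟨n, he.symm⟩

theorem exists_apply_eq (h : IsBranchingSystem σ₁ σ₂) (n : ℕ) :
    (∃ m, σ₁ m = n) ∨ ∃ m, σ₂ m = n := by
  have := h.cover ▸ Set.mem_univ n
  exact this

end IsBranchingSystem

/-- The points reached by `σ₁` and `σ₂` from a point in the range of every iterate of `σ₁`. -/
inductive TailOne (σ₁ σ₂ : ℕ → ℕ) : ℕ → Prop
  | base {n : ℕ} (hn : n ∈ iteratedRange σ₁) : TailOne σ₁ σ₂ n
  | step₁ {n : ℕ} (hn : TailOne σ₁ σ₂ n) : TailOne σ₁ σ₂ (σ₁ n)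
  | step₂ {n : ℕ} (hn : TailOne σ₁ σ₂ n) : TailOne σ₁ σ₂ (σ₂ n)

namespace TailOne

variable {σ₁ σ₂ : ℕ → ℕ}

/-- Stability under predecessors makes the complement of `TailOne` stable under `σ₁` and `σ₂`, so
the retained basis vectors are stable under both isometries. -/
theorem of_apply (hσ : IsBranchingSystem σ₁ σ₂) {n : ℕ} (hn : TailOne σ₁ σ₂ n) :
    ∀ m, σ₁ m = n ∨ σ₂ m = n → TailOne σ₁ σ₂ m := by
  cases hn with
  | base hn =>
    rintro m (rfl | rfl)
    · exact base ((apply_mem_iteratedRange_iff hσ.injective₁).1 hn)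
    · obtain ⟨k, -, hk⟩ := exists_mem_iteratedRange_apply_eq hσ.injective₁ hn
      exact absurd hk (hσ.apply_ne _ _)
  | step₁ hn =>
    rintro m (h | h)
    · exact hσ.injective₁ h ▸ hn
    · exact absurd h.symm (hσ.apply_ne _ _)
  | step₂ hn =>
    rintro m (h | h)
    · exact absurd h (hσ.apply_ne _ _)
    · exact hσ.injective₂ h ▸ hn

theorem notMem_iteratedRange (hσ : IsBranchingSystem σ₁ σ₂) {n : ℕ} (hn : TailOne σ₁ σ₂ n) :
    n ∉ iteratedRange σ₂ := by
  induction hn with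
  | base hn =>
    intro h
    obtain ⟨k, -, rfl⟩ := exists_mem_iteratedRange_apply_eq hσ.injective₁ hn
    obtain ⟨l, -, hl⟩ := exists_mem_iteratedRange_apply_eq hσ.injective₂ h
    exact hσ.apply_ne _ _ hl.symm
  | step₁ hn ih =>
    intro h
    obtain ⟨l, -, hl⟩ := exists_mem_iteratedRange_apply_eq hσ.injective₂ h
    exact hσ.apply_ne _ _ hl.symm
  | step₂ hn ih => exact fun h => ih ((apply_mem_iteratedRange_iff hσ.injective₂).1 h)

end TailOne

/-! ### Orbits and closed spans in the Hilbert space. -/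

/-- The smallest set containing `C` and closed under `S₁` and `S₂`. -/
inductive Generated {H : Type*} (S₁ S₂ : H → H) (C : Set H) : H → Prop
  | base {x : H} (hx : x ∈ C) : Generated S₁ S₂ C x
  | step₁ {x : H} (hx : Generated S₁ S₂ C x) : Generated S₁ S₂ C (S₁ x)
  | step₂ {x : H} (hx : Generated S₁ S₂ C x) : Generated S₁ S₂ C (S₂ x)

theorem Generated.countable {H : Type*} (S₁ S₂ : H → H) {C : Set H} (hC : C.Countable) :
    {x | Generated S₁ S₂ C x}.Countable := by
  have : Countable C := hC
  -- Each orbit element is a finite word in `S₁`, `S₂` applied to a point of `C`.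
  refine (Set.countable_range fun p : List Bool × C =>
    p.1.foldr (fun b x => if b then S₁ x else S₂ x) p.2.1).mono ?_
  intro x hx
  induction hx with
  | base hx => exact ⟨([], ⟨_, hx⟩), rfl⟩
  | step₁ _ ih =>
    obtain ⟨⟨w, c⟩, rfl⟩ := ih
    exact ⟨(true :: w, c), by simp⟩
  | step₂ _ ih =>
    obtain ⟨⟨w, c⟩, rfl⟩ := ih
    exact ⟨(false :: w, c), by simp⟩

theorem apply_mem_closure_span {H : Type*} [NormedAddCommGroup H] [InnerProductSpace ℂ H]
    {B : Set H} {S : H →L[ℂ] H} (hS : ∀ x ∈ B, S x ∈ B) {x : H}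
    (hx : x ∈ (Submodule.span ℂ B).topologicalClosure) :
    S x ∈ (Submodule.span ℂ B).topologicalClosure := by
  refine map_mem_closure S.continuous hx fun y hy => ?_
  have : Submodule.span ℂ B ≤ (Submodule.span ℂ B).comap (S : H →ₗ[ℂ] H) :=
    Submodule.span_le.2 fun z hz => Submodule.subset_span (hS z hz)
  exact this hy

section Basis

variable {H : Type*} [NormedAddCommGroup H] [InnerProductSpace ℂ H] [CompleteSpace H]

theorem inner_map_map_of_star_mul_self {S : H →L[ℂ] H} (h : star S * S = 1) (x y : H) :
    ⟪S x, S y⟫_ℂ = ⟪x, y⟫_ℂ := by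
  rw [← ContinuousLinearMap.adjoint_inner_right, ← ContinuousLinearMap.star_eq_adjoint,
    ← mul_apply_eq_comp, h, one_apply_eq_self]

/-- Sandwiching `a a* + b b* = 1` between `a*` and `b` gives `a* b = a* b + a* b`. -/
theorem IsCuntzPair.star_mul_eq_zero {A : Type*} [Ring A] [StarRing A] {a b : A}
    (h : IsCuntzPair a b) : star a * b = 0 := by
  have h' : star a * (a * star a + b * star b) * b = star a * b := by rw [h.sum_range, mul_one]
  have h'' : star a * (a * star a + b * star b) * b =
      (star a * a) * (star a * b) + (star a * b) * (star b * b) := by noncomm_ring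
  rw [h'', h.isometry₁, h.isometry₂, one_mul, mul_one] at h'
  exact left_eq_add.1 h'.symm

/-- A representation of `Q₂` on `H`, given by the operators `U` and `S₂` together with
`S₁ = U S₂`, whose isometries `S₁`, `S₂` permute the basis `e` through `σ₁`, `σ₂`. -/
structure PermutedSystem (e : HilbertBasis ℕ ℂ H) (σ₁ σ₂ : ℕ → ℕ) (U S₁ S₂ : H →L[ℂ] H) :
    Prop where
  branching : IsBranchingSystem σ₁ σ₂
  apply₁ : ∀ n, S₁ (e n) = e (σ₁ n)
  apply₂ : ∀ n, S₂ (e n) = e (σ₂ n)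
  cuntz : IsCuntzPair S₁ S₂
  unitary : U ∈ unitary (H →L[ℂ] H)
  map₂ : ∀ x, U (S₂ x) = S₁ x
  map₁ : ∀ x, U (S₁ x) = S₂ (U x)

namespace PermutedSystem

variable {e : HilbertBasis ℕ ℂ H} {σ₁ σ₂ : ℕ → ℕ} {U S₁ S₂ : H →L[ℂ] H}

theorem inner₁ (h : PermutedSystem e σ₁ σ₂ U S₁ S₂) (x y : H) : ⟪S₁ x, S₁ y⟫_ℂ = ⟪x, y⟫_ℂ :=
  inner_map_map_of_star_mul_self h.cuntz.isometry₁ x y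

theorem inner₂ (h : PermutedSystem e σ₁ σ₂ U S₁ S₂) (x y : H) : ⟪S₂ x, S₂ y⟫_ℂ = ⟪x, y⟫_ℂ :=
  inner_map_map_of_star_mul_self h.cuntz.isometry₂ x y

theorem innerU (h : PermutedSystem e σ₁ σ₂ U S₁ S₂) (x y : H) : ⟪U x, U y⟫_ℂ = ⟪x, y⟫_ℂ :=
  inner_map_map_of_star_mul_self (Unitary.mem_iff.1 h.unitary).1 x y

theorem inner₁₂ (h : PermutedSystem e σ₁ σ₂ U S₁ S₂) (x y : H) : ⟪S₁ x, S₂ y⟫_ℂ = 0 := by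
  rw [← ContinuousLinearMap.adjoint_inner_right, ← ContinuousLinearMap.star_eq_adjoint,
    ← mul_apply_eq_comp, h.cuntz.star_mul_eq_zero, zero_apply,
    inner_zero_right]

theorem inner₂₁ (h : PermutedSystem e σ₁ σ₂ U S₁ S₂) (x y : H) : ⟪S₂ x, S₁ y⟫_ℂ = 0 :=
  inner_eq_zero_symm.1 (h.inner₁₂ y x)

theorem star_apply_apply (h : PermutedSystem e σ₁ σ₂ U S₁ S₂) (x : H) : star U (U x) = x := by
  rw [← mul_apply_eq_comp, (Unitary.mem_iff.1 h.unitary).1,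
    one_apply_eq_self]

theorem apply_star_apply (h : PermutedSystem e σ₁ σ₂ U S₁ S₂) (x : H) : U (star U x) = x := by
  rw [← mul_apply_eq_comp, (Unitary.mem_iff.1 h.unitary).2,
    one_apply_eq_self]

theorem star_apply₁ (h : PermutedSystem e σ₁ σ₂ U S₁ S₂) (x : H) : star U (S₁ x) = S₂ x := by
  rw [← h.map₂, h.star_apply_apply]

theorem star_apply₂ (h : PermutedSystem e σ₁ σ₂ U S₁ S₂) (x : H) :
    star U (S₂ x) = S₁ (star U x) := by
  rw [← h.star_apply_apply (S₁ (star U x)), h.map₁, h.apply_star_apply]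

/-! ### The unitary carries `M₁` to `M₂` and its complement to the complement. -/

/-- This says `U M₁ ⊆ M₂`. By `U S₁ = S₂ U`, one `S₁` is stripped from `e n` against one `S₂` from
`e m`, until `m` falls in the range of `σ₁` and the ranges of `S₁` and `S₂` are orthogonal. -/
theorem inner_apply_of_mem_of_notMem (h : PermutedSystem e σ₁ σ₂ U S₁ S₂) {m n : ℕ}
    (hn : n ∈ iteratedRange σ₁) (hm : m ∉ iteratedRange σ₂) : ⟪e m, U (e n)⟫_ℂ = 0 := by
  obtain ⟨k, hk⟩ := not_forall.1 hm
  clear hm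
  induction k generalizing m n with
  | zero => exact absurd ⟨m, rfl⟩ hk
  | succ k ih =>
    obtain ⟨n, hn', rfl⟩ := exists_mem_iteratedRange_apply_eq h.branching.injective₁ hn
    rw [← h.apply₁, h.map₁]
    rcases h.branching.exists_apply_eq m with ⟨m, rfl⟩ | ⟨m, rfl⟩
    · rw [← h.apply₁, h.inner₁₂]
    · rw [← h.apply₂, h.inner₂]
      exact ih hn' fun hm => hk ((apply_mem_range_iterate_succ_iff h.branching.injective₂).2 hm)

theorem inner_apply_of_notMem_of_mem (h : PermutedSystem e σ₁ σ₂ U S₁ S₂) {m n : ℕ}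
    (hn : n ∉ iteratedRange σ₁) (hm : m ∈ iteratedRange σ₂) : ⟪U (e n), e m⟫_ℂ = 0 := by
  obtain ⟨k, hk⟩ := not_forall.1 hn
  clear hn
  induction k generalizing m n with
  | zero => exact absurd ⟨n, rfl⟩ hk
  | succ k ih =>
    obtain ⟨m, hm', rfl⟩ := exists_mem_iteratedRange_apply_eq h.branching.injective₂ hm
    rw [← h.apply₂]
    rcases h.branching.exists_apply_eq n with ⟨n, rfl⟩ | ⟨n, rfl⟩
    · rw [← h.apply₁, h.map₁, h.inner₂]
      exact ih hm' fun hn => hk ((apply_mem_range_iterate_succ_iff h.branching.injective₁).2 hn)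
    · rw [← h.apply₂, h.map₂, h.inner₁₂]

/-! ### The new basis and its invariance. -/

variable (e σ₁ σ₂ U S₁ S₂) in
/-- The basis vectors outside the subrepresentation generated by `⋂ k, S₁ ^ k H`. -/
def oldPart : Set H := {x | ∃ n, ¬ TailOne σ₁ σ₂ n ∧ e n = x}

variable (e σ₁ σ₂ U S₁ S₂) in
/-- The new basis vectors of the subrepresentation generated by `⋂ k, S₁ ^ k H`: the orbit under
`S₁`, `S₂` of the preimages under `U` of the basis vectors in `⋂ k, S₂ ^ k H`. -/
def newPart : Set H :=
  {x | Generated S₁ S₂ ((fun n => star U (e n)) '' iteratedRange σ₂) x}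

variable (e σ₁ σ₂ U S₁ S₂) in
/-- An orthonormal basis permuted by `U`, `S₁` and `S₂`. -/
def newBasis : Set H := oldPart e σ₁ σ₂ ∪ newPart e σ₂ U S₁ S₂

theorem apply₁_mem (h : PermutedSystem e σ₁ σ₂ U S₁ S₂) {x : H}
    (hx : x ∈ newBasis e σ₁ σ₂ U S₁ S₂) : S₁ x ∈ newBasis e σ₁ σ₂ U S₁ S₂ := by
  rcases hx with ⟨n, hn, rfl⟩ | hx
  · exact .inl ⟨σ₁ n, fun hn' => hn (hn'.of_apply h.branching _ (.inl rfl)), (h.apply₁ n).symm⟩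
  · exact .inr (Generated.step₁ hx)

theorem apply₂_mem (h : PermutedSystem e σ₁ σ₂ U S₁ S₂) {x : H}
    (hx : x ∈ newBasis e σ₁ σ₂ U S₁ S₂) : S₂ x ∈ newBasis e σ₁ σ₂ U S₁ S₂ := by
  rcases hx with ⟨n, hn, rfl⟩ | hx
  · exact .inl ⟨σ₂ n, fun hn' => hn (hn'.of_apply h.branching _ (.inr rfl)), (h.apply₂ n).symm⟩
  · exact .inr (Generated.step₂ hx)

theorem apply_mem (h : PermutedSystem e σ₁ σ₂ U S₁ S₂) {x : H}
    (hx : x ∈ newBasis e σ₁ σ₂ U S₁ S₂) : U x ∈ newBasis e σ₁ σ₂ U S₁ S₂ := by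
  rcases hx with ⟨n, hn, rfl⟩ | hx
  -- An index outside `TailOne` is not in every `σ₁^k`-range, so stripping `σ₁` stops at some `σ₂
  -- m`, where `U S₂ = S₁` applies.
  · obtain ⟨k, hk⟩ := not_forall.1 fun hn' => hn (.base hn')
    induction k generalizing n with
    | zero => exact absurd ⟨n, rfl⟩ hk
    | succ k ih =>
      rcases h.branching.exists_apply_eq n with ⟨n, rfl⟩ | ⟨n, rfl⟩
      · rw [← h.apply₁, h.map₁]
        exact h.apply₂_mem (ih n (fun hn' => hn hn'.step₁) fun hn' =>
          hk ((apply_mem_range_iterate_succ_iff h.branching.injective₁).2 hn'))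
      · rw [← h.apply₂, h.map₂]
        exact h.apply₁_mem (.inl ⟨n, fun hn' => hn hn'.step₂, rfl⟩)
  · induction hx with
    | base hx =>
      obtain ⟨m, hm, rfl⟩ := hx
      exact .inl ⟨m, fun hm' => hm'.notMem_iteratedRange h.branching hm,
        (h.apply_star_apply _).symm⟩
    | step₁ hx ih => exact h.map₁ _ ▸ h.apply₂_mem ih
    | step₂ hx ih => exact h.map₂ _ ▸ h.apply₁_mem (.inr hx)

/-- Every base vector is `S₁` of another base vector, because `U* S₂ = S₁ U*`. This lets an `S₁` be
stripped from base vectors indefinitely. -/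
theorem exists_apply₁_eq (h : PermutedSystem e σ₁ σ₂ U S₁ S₂) {m : ℕ}
    (hm : m ∈ iteratedRange σ₂) : ∃ k ∈ iteratedRange σ₂, S₁ (star U (e k)) = star U (e m) := by
  obtain ⟨k, hk, rfl⟩ := exists_mem_iteratedRange_apply_eq h.branching.injective₂ hm
  exact ⟨k, hk, by rw [← h.apply₂, h.star_apply₂]⟩

theorem star_apply_mem (h : PermutedSystem e σ₁ σ₂ U S₁ S₂) {x : H}
    (hx : x ∈ newBasis e σ₁ σ₂ U S₁ S₂) : star U x ∈ newBasis e σ₁ σ₂ U S₁ S₂ := by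
  rcases hx with ⟨n, hn, rfl⟩ | hx
  · by_cases hn₂ : n ∈ iteratedRange σ₂
    · exact .inr (.base ⟨n, hn₂, rfl⟩)
    obtain ⟨k, hk⟩ := not_forall.1 hn₂
    clear hn₂
    induction k generalizing n with
    | zero => exact absurd ⟨n, rfl⟩ hk
    | succ k ih =>
      rcases h.branching.exists_apply_eq n with ⟨n, rfl⟩ | ⟨n, rfl⟩
      · rw [← h.apply₁, h.star_apply₁]
        exact h.apply₂_mem (.inl ⟨n, fun hn' => hn hn'.step₁, rfl⟩)
      · rw [← h.apply₂, h.star_apply₂]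
        exact h.apply₁_mem (ih n (fun hn' => hn hn'.step₂) fun hn' =>
          hk ((apply_mem_range_iterate_succ_iff h.branching.injective₂).2 hn'))
  · induction hx with
    | base hx =>
      obtain ⟨m, hm, rfl⟩ := hx
      obtain ⟨k, hk, hkm⟩ := h.exists_apply₁_eq hm
      change star U (star U (e m)) ∈ _
      rw [← hkm, h.star_apply₁]
      exact h.apply₂_mem (.inr (.base ⟨k, hk, rfl⟩))
    | step₁ hx ih => exact h.star_apply₁ _ ▸ h.apply₂_mem (.inr hx)
    | step₂ hx ih => exact h.star_apply₂ _ ▸ h.apply₁_mem ih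

/-! ### Orthonormality. -/

theorem inner_oldPart_newPart (h : PermutedSystem e σ₁ σ₂ U S₁ S₂) {n : ℕ}
    (hn : ¬ TailOne σ₁ σ₂ n) {x : H} (hx : x ∈ newPart e σ₂ U S₁ S₂) : ⟪e n, x⟫_ℂ = 0 := by
  induction hx generalizing n with
  | base hx =>
    obtain ⟨m, hm, rfl⟩ := hx
    rw [← h.innerU, h.apply_star_apply]
    exact h.inner_apply_of_notMem_of_mem (fun hn' => hn (.base hn')) hm
  | step₁ hx ih =>
    rcases h.branching.exists_apply_eq n with ⟨n, rfl⟩ | ⟨n, rfl⟩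
    · rw [← h.apply₁, h.inner₁]
      exact ih fun hn' => hn hn'.step₁
    · rw [← h.apply₂, h.inner₂₁]
  | step₂ hx ih =>
    rcases h.branching.exists_apply_eq n with ⟨n, rfl⟩ | ⟨n, rfl⟩
    · rw [← h.apply₁, h.inner₁₂]
    · rw [← h.apply₂, h.inner₂]
      exact ih fun hn' => hn hn'.step₂

theorem eq_or_inner_star_apply_newPart (h : PermutedSystem e σ₁ σ₂ U S₁ S₂) {m : ℕ}
    (hm : m ∈ iteratedRange σ₂) {y : H} (hy : y ∈ newPart e σ₂ U S₁ S₂) :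
    star U (e m) = y ∨ ⟪star U (e m), y⟫_ℂ = 0 := by
  induction hy generalizing m with
  | base hx =>
    obtain ⟨k, -, rfl⟩ := hx
    rcases eq_or_ne m k with rfl | hmk
    · exact .inl rfl
    · refine .inr ?_
      rw [← h.innerU, h.apply_star_apply, h.apply_star_apply]
      exact e.orthonormal.2 hmk
  | step₁ hx ih =>
    obtain ⟨k, hk, hkm⟩ := h.exists_apply₁_eq hm
    rw [← hkm, h.inner₁]
    exact (ih hk).imp_left (congrArg S₁)
  | step₂ hx ih =>
    obtain ⟨k, hk, hkm⟩ := h.exists_apply₁_eq hm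
    rw [← hkm, h.inner₁₂]
    exact .inr rfl

/-- Words do not label the orbit uniquely, since `S₁` permutes the base vectors; hence the dichotomy
in place of an indexed family. -/
theorem eq_or_inner_newPart (h : PermutedSystem e σ₁ σ₂ U S₁ S₂) {x y : H}
    (hx : x ∈ newPart e σ₂ U S₁ S₂) (hy : y ∈ newPart e σ₂ U S₁ S₂) :
    x = y ∨ ⟪x, y⟫_ℂ = 0 := by
  induction hx generalizing y with
  | base hx =>
    obtain ⟨m, hm, rfl⟩ := hx
    exact h.eq_or_inner_star_apply_newPart hm hy
  | step₁ hx ih =>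
    cases hy with
    | base hy =>
      obtain ⟨m, hm, rfl⟩ := hy
      exact (h.eq_or_inner_star_apply_newPart hm (Generated.step₁ hx)).imp Eq.symm
        inner_eq_zero_symm.1
    | step₁ hy => exact (ih hy).imp (congrArg S₁) fun h' => (h.inner₁ _ _).trans h'
    | step₂ hy => exact .inr (h.inner₁₂ _ _)
  | step₂ hx ih =>
    cases hy with
    | base hy =>
      obtain ⟨m, hm, rfl⟩ := hy
      exact (h.eq_or_inner_star_apply_newPart hm (Generated.step₂ hx)).imp Eq.symm
        inner_eq_zero_symm.1
    | step₁ hy => exact .inr (h.inner₂₁ _ _)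
    | step₂ hy => exact (ih hy).imp (congrArg S₂) fun h' => (h.inner₂ _ _).trans h'

theorem inner_self_newBasis (h : PermutedSystem e σ₁ σ₂ U S₁ S₂) {x : H}
    (hx : x ∈ newBasis e σ₁ σ₂ U S₁ S₂) : ⟪x, x⟫_ℂ = 1 := by
  have he (n : ℕ) : ⟪e n, e n⟫_ℂ = 1 := by
    rw [inner_self_eq_norm_sq_to_K, e.orthonormal.1 n]
    simp
  rcases hx with ⟨n, hn, rfl⟩ | hx
  · exact he n
  · induction hx with
    | base hx =>
      obtain ⟨m, hm, rfl⟩ := hx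
      rw [← h.innerU, h.apply_star_apply, he]
    | step₁ hx ih => rw [h.inner₁, ih]
    | step₂ hx ih => rw [h.inner₂, ih]

theorem orthonormal_newBasis (h : PermutedSystem e σ₁ σ₂ U S₁ S₂) :
    Orthonormal ℂ (Subtype.val : newBasis e σ₁ σ₂ U S₁ S₂ → H) := by
  refine ⟨fun x => ?_, ?_⟩
  · refine (pow_eq_one_iff_of_nonneg (norm_nonneg _) two_ne_zero).1 ?_
    rw [← inner_self_eq_norm_sq (𝕜 := ℂ), h.inner_self_newBasis x.2, RCLike.one_re]
  · rintro ⟨x, hx⟩ ⟨y, hy⟩ hxy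
    have hxy' : x ≠ y := fun h' => hxy (Subtype.ext h')
    rcases hx with ⟨n, hn, rfl⟩ | hx <;> rcases hy with ⟨m, hm, rfl⟩ | hy
    · exact e.orthonormal.2 fun h' => hxy' (congrArg e h')
    · exact h.inner_oldPart_newPart hn hy
    · exact inner_eq_zero_symm.1 (h.inner_oldPart_newPart hm hx)
    · exact (h.eq_or_inner_newPart hx hy).resolve_left hxy'

/-! ### Totality and enumeration by `ℕ`. -/

theorem basis_mem_closure_span (h : PermutedSystem e σ₁ σ₂ U S₁ S₂) (n : ℕ) :
    e n ∈ (Submodule.span ℂ (newBasis e σ₁ σ₂ U S₁ S₂)).topologicalClosure := by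
  have hsub {x : H} (hx : x ∈ newBasis e σ₁ σ₂ U S₁ S₂) :
      x ∈ (Submodule.span ℂ (newBasis e σ₁ σ₂ U S₁ S₂)).topologicalClosure :=
    Submodule.le_topologicalClosure _ (Submodule.subset_span hx)
  by_cases hn : TailOne σ₁ σ₂ n
  · induction hn with
    | @base n hn =>
      -- `U (e n)` expands in the vectors of `M₂`, all retained in the new basis, and `U*` preserves
      -- the closed span.
      rw [← h.star_apply_apply (e n)]
      refine apply_mem_closure_span (fun _ hx => h.star_apply_mem hx) ?_
      refine (Submodule.isClosed_topologicalClosure _).mem_of_tendsto (e.hasSum_repr (U (e n)))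
        (Filter.Eventually.of_forall fun s => Submodule.sum_mem _ fun m _ => ?_)
      by_cases hm : m ∈ iteratedRange σ₂
      · exact Submodule.smul_mem _ _
          (hsub (.inl ⟨m, fun hm' => hm'.notMem_iteratedRange h.branching hm, rfl⟩))
      · rw [e.repr_apply_apply, h.inner_apply_of_mem_of_notMem hn hm, zero_smul]
        exact Submodule.zero_mem _
    | step₁ _ ih => exact h.apply₁ _ ▸ apply_mem_closure_span (fun _ hx => h.apply₁_mem hx) ih
    | step₂ _ ih => exact h.apply₂ _ ▸ apply_mem_closure_span (fun _ hx => h.apply₂_mem hx) ih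
  · exact hsub (.inl ⟨n, hn, rfl⟩)

theorem closure_span_newBasis (h : PermutedSystem e σ₁ σ₂ U S₁ S₂) :
    (Submodule.span ℂ (newBasis e σ₁ σ₂ U S₁ S₂)).topologicalClosure = ⊤ := by
  rw [← top_le_iff, ← e.dense_span]
  refine Submodule.topologicalClosure_minimal _ (Submodule.span_le.2 ?_)
    (Submodule.isClosed_topologicalClosure _)
  rintro _ ⟨n, rfl⟩
  exact h.basis_mem_closure_span n

theorem countable_newBasis : (newBasis e σ₁ σ₂ U S₁ S₂).Countable := by
  refine Set.Countable.union ?_ (Generated.countable _ _ ((Set.to_countable _).image _))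
  refine (Set.countable_range e).mono ?_
  rintro _ ⟨n, -, rfl⟩
  exact ⟨n, rfl⟩

theorem infinite_newBasis (h : PermutedSystem e σ₁ σ₂ U S₁ S₂) :
    (newBasis e σ₁ σ₂ U S₁ S₂).Infinite := by
  intro hfin
  have hfd : FiniteDimensional ℂ (Submodule.span ℂ (newBasis e σ₁ σ₂ U S₁ S₂)) :=
    FiniteDimensional.span_of_finite ℂ hfin
  have htop : Submodule.span ℂ (newBasis e σ₁ σ₂ U S₁ S₂) = ⊤ := by
    rw [← h.closure_span_newBasis]
    -- A finite-dimensional span is closed, hence all of `H`, against the infinite orthonormal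
    -- family `e`.
    exact (Submodule.closed_of_finiteDimensional _).submodule_topologicalClosure_eq.symm
  rw [htop] at hfd
  have : FiniteDimensional ℂ H := Module.Finite.equiv Submodule.topEquiv
  exact not_finite_iff_infinite.2 (inferInstance : Infinite ℕ)
    e.orthonormal.linearIndependent.finite

theorem exists_hilbertBasis (h : PermutedSystem e σ₁ σ₂ U S₁ S₂) :
    ∃ (f : HilbertBasis ℕ ℂ H) (σ τ : ℕ → ℕ), Function.Injective σ ∧ Function.Bijective τ ∧
      (∀ n, S₂ (f n) = f (σ n)) ∧ ∀ n, U (f n) = f (τ n) := by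
  have : Countable (newBasis e σ₁ σ₂ U S₁ S₂) := countable_newBasis
  have : Infinite (newBasis e σ₁ σ₂ U S₁ S₂) := h.infinite_newBasis.to_subtype
  obtain ⟨φ⟩ := nonempty_equiv_of_countable (α := ℕ) (β := newBasis e σ₁ σ₂ U S₁ S₂)
  have hr : Set.range (fun n => (φ n : H)) = newBasis e σ₁ σ₂ U S₁ S₂ := by
    rw [Set.range_comp' Subtype.val φ, φ.surjective.range_eq, Set.image_univ, Subtype.range_val]
  let f : HilbertBasis ℕ ℂ H := HilbertBasis.mk (v := fun n => (φ n : H))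
    (h.orthonormal_newBasis.comp φ φ.injective) (by rw [hr, h.closure_span_newBasis])
  have hf (n : ℕ) : f n = (φ n : H) := by simp [f]
  have hinj : Function.Injective f := f.orthonormal.linearIndependent.injective
  have hS (n : ℕ) : S₂ (f n) = f (φ.symm ⟨S₂ (φ n), h.apply₂_mem (φ n).2⟩) := by simp [hf]
  have hU (n : ℕ) : U (f n) = f (φ.symm ⟨U (φ n), h.apply_mem (φ n).2⟩) := by simp [hf]
  refine ⟨f, _, _, fun m n hmn => ?_, ⟨fun m n hmn => ?_, fun n => ?_⟩, hS, hU⟩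
  · have hmn' : S₂ (f m) = S₂ (f n) := by rw [hS, hS]; exact congrArg f hmn
    have hS₂ (x : H) : star S₂ (S₂ x) = x := by
      rw [← mul_apply_eq_comp, h.cuntz.isometry₂, one_apply_eq_self]
    exact hinj (by rw [← hS₂ (f m), hmn', hS₂])
  · have hmn' : U (f m) = U (f n) := by rw [hU, hU]; exact congrArg f hmn
    exact hinj (by rw [← h.star_apply_apply (f m), hmn', h.star_apply_apply])
  -- Surjectivity of `τ` is where stability under `U*` is needed.
  · refine ⟨φ.symm ⟨star U (φ n), h.star_apply_mem (φ n).2⟩, hinj ?_⟩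
    rw [← hU, hf, hf, Equiv.apply_symm_apply, h.apply_star_apply]

end PermutedSystem

/-! ### Back to representations. -/

/-- Every extension to `Q₂` of a permutative representation of `O₂` is permutative. -/
theorem IsPermutativeCuntz.isPermutativeTwoAdic {π : CuntzAlgebra →⋆ₐ[ℂ] (H →L[ℂ] H)}
    (hπ : IsPermutativeCuntz π) {ρ : TwoAdicAlgebra →⋆ₐ[ℂ] (H →L[ℂ] H)} (hρ : Extends ρ π) :
    IsPermutativeTwoAdic ρ := by
  obtain ⟨e, σ₁, σ₂, hσ, h₁, h₂⟩ := hπ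
  have hX₁ : π cuntzX₁ = ρ twoAdicU * ρ twoAdicS := by
    rw [← map_mul, ← inclusion_cuntzX₁, ← hρ, StarAlgHom.comp_apply]
  have hX₂ : π cuntzX₂ = ρ twoAdicS := by
    rw [← inclusion_cuntzX₂, ← hρ, StarAlgHom.comp_apply]
  have hcomm : ρ twoAdicS * ρ twoAdicU = ρ twoAdicU * (ρ twoAdicU * ρ twoAdicS) := by
    rw [← map_mul, isTwoAdicPair_twoAdic.comm, map_mul, map_pow, pow_two, mul_assoc]
  refine PermutedSystem.exists_hilbertBasis (e := e) (σ₁ := σ₁) (σ₂ := σ₂)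
    (S₁ := π cuntzX₁) ⟨hσ, h₁, hX₂ ▸ h₂, ⟨?_, ?_, ?_⟩, ?_, ?_, ?_⟩
  · rw [← map_star, ← map_mul, isCuntzPair_cuntzX.isometry₁, map_one]
  · rw [← map_star, ← map_mul, isTwoAdicPair_twoAdic.isometry, map_one]
  · rw [← hX₂, ← map_star, ← map_star, ← map_mul, ← map_mul, ← map_add,
      isCuntzPair_cuntzX.sum_range, map_one]
  · exact Unitary.map_mem ρ isTwoAdicPair_twoAdic.unitary
  · intro x
    rw [hX₁, mul_apply_eq_comp]
  · intro x
    rw [hX₁, ← mul_apply_eq_comp, ← hcomm, mul_apply_eq_comp]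

end Basis

end TwoAdic

theorem mainTheorem3 {H : Type*} [NormedAddCommGroup H] [InnerProductSpace ℂ H] [CompleteSpace H]
    (π : TwoAdic.CuntzAlgebra →⋆ₐ[ℂ] (H →L[ℂ] H)) (hπ : TwoAdic.IsPermutativeCuntz π)
    (hext : ∃ ρ : TwoAdic.TwoAdicAlgebra →⋆ₐ[ℂ] (H →L[ℂ] H), TwoAdic.Extends ρ π) :
    ∃ ρ : TwoAdic.TwoAdicAlgebra →⋆ₐ[ℂ] (H →L[ℂ] H),
      TwoAdic.Extends ρ π ∧ TwoAdic.IsPermutativeTwoAdic ρ := by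
  obtain ⟨ρ, hρ⟩ := hext
  exact ⟨ρ, hρ, hπ.isPermutativeTwoAdic hρ⟩
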